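/- Let $p$ be a prime and let $\mathbb{P}^1(\mathbb{Q}_p)=\mathbb{Q}_p\cup\{\infty\}$ carry its usual topology (as a compact space). For a map $\phi:\mathbb{P}^1(\mathbb{Q}_p)\to\mathbb{P}^1(\mathbb{Q}_p)$, a minimal subsystem is a pair $(E,\phi|_E)$ where $E\subset\mathbb{P}^1(\mathbb{Q}_p)$ is a nonempty compact set with $\phi(E)\subset E$ such that the closure of the orbit $\{\phi^n(x):n\ge 0\}$ is equal to $E$ for every $x\in E$. Let $a,b,c,d\in\mathbb{Q}_p$ with $ad-bc\neq 0$, and let $\phi(x)=\dfrac{ax+b}{cx+d}$ be the corresponding homographic map of $\mathbb{P}^1(\mathbb{Q}_p)$. Suppose that $\phi$ has no fixed point in $\mathbb{P}^1(\mathbb{Q}_p)$ and that $\phi^n\neq \mathrm{id}$ for all integers $n>0$. Then: 1. $(\mathbb{P}^1(\mathbb{Q}_p),\phi)$ has only finitely many minimal subsystems, and $\mathbb{P}^1(\mathbb{Q}_p)$ is their disjoint union. 2. Any two of these minimal subsystems $(E,\phi|_E)$, $(F,\phi|_F)$ are topologically conjugate, that is, there is a homeomorphism $h:E\to F$ with $h\circ\phi|_E=\phi|_F\circ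 h$. 3. The number of minimal subsystems is determined by $\lambda$: there is a function $N$ on an algebraic closure $\overline{\mathbb{Q}_p}$ with values in $\mathbb{N}$, depending only on $p$, such that for all $a,b,c,d$ as above and for either choice of the square root $\sqrt{\Delta}\in\overline{\mathbb{Q}_p}$ of $\Delta=(d-a)^2+4bc$, the number of minimal subsystems of $(\mathbb{P}^1(\mathbb{Q}_p),\phi)$ is $N(\lambda)$, where $$\lambda=\frac{a+d+\sqrt{\Delta}}{a+d-\sqrt{\Delta}}.$$ -/

import Mathlib

open scoped OnePoint

noncomputable section

/-- The homographic map `x ↦ (a x + b) / (c x + d)` on the projective line `P¹(K) = K ∪ {∞}`.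
In homogeneous coordinates it sends `[x, y]` to `[a x + b y, c x + d y]`, where `x` stands for
`[x, 1]` and `∞` for `[1, 0]`. For a locally compact field the topology of `OnePoint K`
(one-point compactification) is the usual topology of `P¹(K)`. -/
def homographic {K : Type*} [Field K] (a b c d : K) (z : OnePoint K) : OnePoint K :=
  open Classical in
  z.elim (if c = 0 then ∞ else ((a / c : K) : OnePoint K))
    (fun x => if c * x + d = 0 then ∞ else (((a * x + b) / (c * x + d) : K) : OnePoint K))

/-- `(E, φ)` is a minimal subsystem of `(X, φ)`: `E` is a nonempty compact set, `φ(E) ⊆ E`, and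
every point of `E` has a forward orbit `{φⁿ(x) : n ≥ 0}` whose closure is exactly `E`. -/
structure IsMinimalSubsystem {X : Type*} [TopologicalSpace X] (φ : X → X) (E : Set X) :
    Prop where
  nonempty : E.Nonempty
  isCompact : IsCompact E
  mapsTo : Set.MapsTo φ E E
  closure_orbit : ∀ x ∈ E, closure (Set.range fun n : ℕ => φ^[n] x) = E

/-- The subsystems `(E, φ)` and `(F, φ)` are topologically conjugate: `E` and `F` are
`φ`-invariant and a homeomorphism from `E` onto `F` intertwines the two restrictions of `φ`. -/
def SubsystemsConjugate {X : Type*} [TopologicalSpace X] (φ : X → X) (E F : Set X) : Prop :=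
  ∃ (hE : Set.MapsTo φ E E) (hF : Set.MapsTo φ F F) (h : E ≃ₜ F),
    Function.Semiconj h (hE.restrict φ E E) (hF.restrict φ F F)

end

open Set Filter Topology Function Pointwise Bornology

/-! ### Transport of minimal subsystems along a homeomorphism. -/

section Dynamics

variable {X Y : Type*} [TopologicalSpace X] [TopologicalSpace Y]

/-! Having no fixed point and infinite order forces nonzero trace, so `φ` is affinely conjugate to
`x ↦ -q / (x + 1)` with `q = det / trace ^ 2`, and `X ^ 2 + X + q` has no root. Hence `L = K[M]`, `M
^ 2 - M + q = 0`, is a quadratic field, the projective line is the compact abelian group `L^× /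
K^×`, and `φ` becomes translation by the class of `M` (`exists_semiconj_normTorus`).

For translation by `g` in a compact abelian group, the minimal subsystems are the cosets of the
closure `H` of `⟨g⟩`; they partition the group and translations conjugate them. They are finitely
many because `H` is open (`isOpen_topologicalClosure_zpowers`): some power of `g` is close to `1`
but different from it, and near `1` the group law is `p`-adic addition up to a quadratic error, so a
closed subgroup containing such an element contains a ball.

The number depends only on `q`, and `q = λ / (1 + λ) ^ 2`. -/

theorem IsMinimalSubsystem.image {φ : X → X} {ψ : Y → Y} (h : X ≃ₜ Y) (hs : Semiconj h φ ψ)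
    {E : Set X} (hE : IsMinimalSubsystem φ E) : IsMinimalSubsystem ψ (h '' E) where
  nonempty := hE.nonempty.image h
  isCompact := hE.isCompact.image h.continuous
  mapsTo := by
    rintro _ ⟨x, hx, rfl⟩
    exact ⟨φ x, hE.mapsTo hx, hs x⟩
  closure_orbit := by
    rintro _ ⟨x, hx, rfl⟩
    rw [← hE.closure_orbit x hx, h.image_closure, ← range_comp]
    congr 2
    ext n
    exact ((hs.iterate_right n) x).symm

theorem Function.Semiconj.homeomorph_symm {φ : X → X} {ψ : Y → Y} {h : X ≃ₜ Y}
    (hs : Semiconj h φ ψ) : Semiconj h.symm ψ φ := fun y => by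
  rw [h.symm_apply_eq, hs, h.apply_symm_apply]

theorem setOf_isMinimalSubsystem_eq_image {φ : X → X} {ψ : Y → Y} (h : X ≃ₜ Y)
    (hs : Semiconj h φ ψ) :
    {F | IsMinimalSubsystem ψ F} = (fun E => h '' E) '' {E | IsMinimalSubsystem φ E} := by
  ext F
  refine ⟨fun hF => ⟨h.symm '' F, hF.image h.symm hs.homeomorph_symm, ?_⟩, ?_⟩
  · simp [image_image]
  · rintro ⟨E, hE, rfl⟩
    exact hE.image h hs

theorem ncard_isMinimalSubsystem_congr {φ : X → X} {ψ : Y → Y} (h : X ≃ₜ Y)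
    (hs : Semiconj h φ ψ) :
    {F | IsMinimalSubsystem ψ F}.ncard = {E | IsMinimalSubsystem φ E}.ncard := by
  rw [setOf_isMinimalSubsystem_eq_image h hs]
  exact ncard_image_of_injective _ h.injective.image_injective

theorem pairwiseDisjoint_isMinimalSubsystem (φ : X → X) :
    {E | IsMinimalSubsystem φ E}.PairwiseDisjoint id := by
  intro E hE F hF hne
  refine Set.disjoint_left.2 fun x hx hx' => hne ?_
  rw [← hE.closure_orbit x hx, ← hF.closure_orbit x hx']

theorem subsystemsConjugate_image {φ : X → X} (h : X ≃ₜ X) (hs : Semiconj h φ φ) {E : Set X}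
    (hE : MapsTo φ E E) : SubsystemsConjugate φ E (h '' E) := by
  have hF : MapsTo φ (h '' E) (h '' E) := by
    rintro _ ⟨x, hx, rfl⟩
    exact ⟨φ x, hE hx, hs x⟩
  exact ⟨hE, hF, h.image E, fun x => Subtype.ext (hs x)⟩

theorem SubsystemsConjugate.image {φ : X → X} {ψ : Y → Y} (h : X ≃ₜ Y) (hs : Semiconj h φ ψ)
    {E F : Set X} (hEF : SubsystemsConjugate φ E F) :
    SubsystemsConjugate ψ (h '' E) (h '' F) := by
  obtain ⟨hE, hF, k, hk⟩ := hEF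
  have hE' : MapsTo ψ (h '' E) (h '' E) := by
    rintro _ ⟨x, hx, rfl⟩
    exact ⟨φ x, hE hx, hs x⟩
  have hF' : MapsTo ψ (h '' F) (h '' F) := by
    rintro _ ⟨x, hx, rfl⟩
    exact ⟨φ x, hF hx, hs x⟩
  refine ⟨hE', hF', ((h.image E).symm.trans k).trans (h.image F), ?_⟩
  intro y
  obtain ⟨x, rfl⟩ := (h.image E).surjective y
  have h1 : hE'.restrict ψ _ _ (h.image E x) = h.image E (hE.restrict φ E E x) :=
    Subtype.ext (hs x).symm
  have h2 : hF'.restrict ψ _ _ (h.image F (k x)) = h.image F (hF.restrict φ F F (k x)) :=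
    Subtype.ext (hs _).symm
  rw [h1]
  simp only [Homeomorph.trans_apply, Homeomorph.symm_apply_apply]
  rw [h2, hk x]

end Dynamics

/-! ### Translations of compact abelian groups. -/

section Translation

variable {G : Type*} [CommGroup G] [TopologicalSpace G] [IsTopologicalGroup G] [CompactSpace G]

/-- By compactness the positive powers of `g` already accumulate at its inverses, so the closure of
a forward orbit is a full coset. -/
theorem closure_range_iterate_mul_left (g x : G) :
    closure (range fun n : ℕ => (g * ·)^[n] x) =
      x • ((Subgroup.zpowers g).topologicalClosure : Set G) := by
  have h1 : (range fun n : ℕ => (g * ·)^[n] x) = x • (range fun n : ℕ => g ^ n) := by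
    rw [← image_smul, ← range_comp]
    congr 1
    ext n
    simp [mul_left_iterate, mul_comm]
  rw [h1, closure_smul, ← closure_range_zpow_eq_pow]
  rfl

theorem isMinimalSubsystem_mul_left_iff (g : G) (E : Set G) :
    IsMinimalSubsystem (g * ·) E ↔
      ∃ x : G, E = x • ((Subgroup.zpowers g).topologicalClosure : Set G) := by
  set H := (Subgroup.zpowers g).topologicalClosure with hH
  have hg : g ∈ H := Subgroup.le_topologicalClosure _ (Subgroup.mem_zpowers g)
  constructor
  · intro hE
    obtain ⟨x, hx⟩ := hE.nonempty
    exact ⟨x, by rw [← hE.closure_orbit x hx, closure_range_iterate_mul_left]⟩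
  · rintro ⟨x, rfl⟩
    refine ⟨⟨x, ?_⟩, ?_, ?_, ?_⟩
    · simpa using mem_smul_set.2 ⟨1, H.one_mem, by simp⟩
    · exact (Subgroup.isClosed_topologicalClosure _).isCompact.smul x
    · rintro _ ⟨y, hy, rfl⟩
      exact ⟨g * y, H.mul_mem hg hy, by simp [mul_left_comm]⟩
    · rintro _ ⟨y, hy, rfl⟩
      rw [closure_range_iterate_mul_left, ← hH]
      simp only [smul_eq_mul]
      rw [mul_smul, smul_coe_set hy]

theorem finite_isMinimalSubsystem_mul_left (g : G)
    [Finite (G ⧸ (Subgroup.zpowers g).topologicalClosure)] :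
    {E : Set G | IsMinimalSubsystem (g * ·) E}.Finite := by
  set H := (Subgroup.zpowers g).topologicalClosure with hH
  refine (finite_range fun q : G ⧸ H => q.out • (H : Set G)).subset fun E hE => ?_
  obtain ⟨x, rfl⟩ := (isMinimalSubsystem_mul_left_iff g E).1 hE
  refine ⟨(x : G ⧸ H), ?_⟩
  obtain ⟨y, hy⟩ := QuotientGroup.mk_out_eq_mul H x
  simp only [hy]
  rw [mul_smul, smul_coe_set y.2]

theorem sUnion_isMinimalSubsystem_mul_left (g : G) :
    ⋃₀ {E : Set G | IsMinimalSubsystem (g * ·) E} = univ := by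
  refine eq_univ_of_forall fun x => ⟨_, (isMinimalSubsystem_mul_left_iff g _).2 ⟨x, rfl⟩, ?_⟩
  exact mem_smul_set.2 ⟨1, Subgroup.one_mem _, by simp⟩

theorem subsystemsConjugate_mul_left (g : G) {E F : Set G} (hE : IsMinimalSubsystem (g * ·) E)
    (hF : IsMinimalSubsystem (g * ·) F) : SubsystemsConjugate (g * ·) E F := by
  obtain ⟨x, rfl⟩ := (isMinimalSubsystem_mul_left_iff g E).1 hE
  obtain ⟨y, rfl⟩ := (isMinimalSubsystem_mul_left_iff g F).1 hF
  have := subsystemsConjugate_image (φ := (g * ·)) (Homeomorph.mulLeft (y * x⁻¹))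
    (fun z => mul_left_comm (y * x⁻¹) g z) hE.mapsTo
  convert this using 1
  rw [Homeomorph.coe_mulLeft]
  change _ = (y * x⁻¹) • x • ((Subgroup.zpowers g).topologicalClosure : Set G)
  rw [smul_smul, inv_mul_cancel_right]

theorem exists_pos_pow_mem_of_mem_nhds_one (g : G) {U : Set G} (hU : U ∈ 𝓝 (1 : G)) :
    ∃ n : ℕ, 0 < n ∧ g ^ n ∈ U := by
  have h := (mapClusterPt_one_atTop_pow g).frequently hU
  obtain ⟨n, hn, h0⟩ := (h.and_eventually (eventually_gt_atTop 0)).exists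
  exact ⟨n, h0, hn⟩

end Translation

/-! ### Inversion and affine maps as homeomorphisms of the projective line. -/

section Inversion

open Classical in
/-- The inversion `x ↦ 1 / x` of the projective line. -/
noncomputable def projInv {K : Type*} [Field K] (z : OnePoint K) : OnePoint K :=
  z.elim ((0 : K) : OnePoint K) (fun x => if x = 0 then ∞ else ((x⁻¹ : K) : OnePoint K))

variable {K : Type*}

@[simp] theorem projInv_infty [Field K] : projInv (∞ : OnePoint K) = ((0 : K) : OnePoint K) := rfl

@[simp] theorem projInv_zero [Field K] : projInv ((0 : K) : OnePoint K) = ∞ := by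
  simp [projInv]

theorem projInv_coe [Field K] {x : K} (hx : x ≠ 0) :
    projInv (x : OnePoint K) = ((x⁻¹ : K) : OnePoint K) := by
  simp [projInv, hx]

theorem projInv_projInv [Field K] (z : OnePoint K) : projInv (projInv z) = z := by
  induction z using OnePoint.rec with
  | infty => simp
  | coe x =>
    rcases eq_or_ne x 0 with rfl | hx
    · simp
    · rw [projInv_coe hx, projInv_coe (inv_ne_zero hx), inv_inv]

theorem continuous_projInv [NontriviallyNormedField K] [ProperSpace K] :
    Continuous (projInv : OnePoint K → OnePoint K) := by
  have hcob : coclosedCompact K = cobounded K := by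
    rw [coclosedCompact_eq_cocompact, Metric.cobounded_eq_cocompact]
  rw [OnePoint.continuous_iff, continuous_iff_continuousAt, hcob]
  refine ⟨?_, fun x => ?_⟩
  · have h : Tendsto (fun x : K => ((x⁻¹ : K) : OnePoint K)) (cobounded K)
        (𝓝 ((0 : K) : OnePoint K)) :=
      (OnePoint.continuous_coe.tendsto 0).comp tendsto_inv₀_cobounded
    refine h.congr' ?_
    filter_upwards [eventually_ne_cobounded (0 : K)] with x hx
    rw [projInv_coe hx]
  · rcases eq_or_ne x 0 with rfl | hx
    · rw [continuousAt_iff_punctured_nhds, projInv_zero]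
      have h : Tendsto (fun x : K => ((x⁻¹ : K) : OnePoint K)) (𝓝[≠] 0) (𝓝 ∞) := by
        refine OnePoint.tendsto_coe_infty.comp ?_
        rw [hcob]
        exact tendsto_inv₀_nhdsNE_zero
      refine h.congr' ?_
      filter_upwards [self_mem_nhdsWithin] with x hx
      rw [projInv_coe hx]
    · have h : ContinuousAt (fun x : K => ((x⁻¹ : K) : OnePoint K)) x :=
        (OnePoint.continuous_coe.continuousAt).comp (continuousAt_inv₀ hx)
      refine h.congr ?_
      filter_upwards [isOpen_ne.mem_nhds hx] with y hy
      rw [projInv_coe hy]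

/-- The inversion of the projective line as a homeomorphism. -/
noncomputable def projInvHomeomorph [NontriviallyNormedField K] [ProperSpace K] :
    OnePoint K ≃ₜ OnePoint K where
  toFun := projInv
  invFun := projInv
  left_inv := projInv_projInv
  right_inv := projInv_projInv
  continuous_toFun := continuous_projInv
  continuous_invFun := continuous_projInv

/-- The affine map `x ↦ α x + β` as a homeomorphism of the projective line. -/
noncomputable def projAffine [Field K] [TopologicalSpace K] [IsTopologicalRing K] (α β : K)
    (hα : α ≠ 0) : OnePoint K ≃ₜ OnePoint K :=
  Homeomorph.onePointCongr
    { toFun := fun x => α * x + β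
      invFun := fun y => α⁻¹ * (y - β)
      left_inv := fun x => by field_simp; ring
      right_inv := fun y => by field_simp; ring
      continuous_toFun := by fun_prop
      continuous_invFun := by fun_prop }

@[simp] theorem projAffine_infty [Field K] [TopologicalSpace K] [IsTopologicalRing K] {α β : K}
    (hα : α ≠ 0) : projAffine α β hα ∞ = ∞ := rfl

@[simp] theorem projAffine_coe [Field K] [TopologicalSpace K] [IsTopologicalRing K] {α β : K}
    (hα : α ≠ 0) (x : K) : projAffine α β hα x = ((α * x + β : K) : OnePoint K) := rfl

end Inversion

/-! ### The projective line as a topological group. -/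

section NormTorus

/-- The projective line as the group `L^× / K^×`, where `L = K[M]` with `M ^ 2 - M + q = 0` is a
quadratic field extension of `K`: a point `w` of `K` stands for the class of `w + M`, and `∞` for
the class of `1`. -/
def NormTorus {K : Type*} [Field K] (q : K) (_ : ∀ x : K, x * x + x + q ≠ 0) : Type _ :=
  OnePoint K

namespace NormTorus

section Algebra

variable {K : Type*} [Field K] {q : K} {hq : ∀ x : K, x * x + x + q ≠ 0}

open Classical in
/-- Product of the classes of `w + M` and `v + M`. -/
noncomputable def mulCoe (q w v : K) : OnePoint K :=
  if w + v + 1 = 0 then ∞ else (((w * v - q) / (w + v + 1) : K) : OnePoint K)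

/-- From `M ^ 2 = M - q`: `(w + M)(v + M) = (w v - q) + (w + v + 1) M`. -/
noncomputable instance : Mul (NormTorus q hq) where
  mul w v := OnePoint.elim (X := K) w v fun w' => OnePoint.elim (X := K) v w (mulCoe q w')

noncomputable instance : One (NormTorus q hq) where
  one := (∞ : OnePoint K)

/-- The inverse class is that of the conjugate: `w + (1 - M)` is `-1 - w + M` up to sign. -/
noncomputable instance : Inv (NormTorus q hq) where
  inv w := OnePoint.elim (X := K) w (∞ : OnePoint K) fun w' => ((-1 - w' : K) : OnePoint K)

variable (q hq) in
/-- The class of `w + M`. -/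
def ofField (w : K) : NormTorus q hq := (w : OnePoint K)

theorem ofField_mul_of_eq {w v : K} (h : w + v + 1 = 0) :
    ofField q hq w * ofField q hq v = 1 := by
  change mulCoe q w v = ∞
  simp [mulCoe, h]

theorem ofField_mul_of_ne {w v : K} (h : w + v + 1 ≠ 0) :
    ofField q hq w * ofField q hq v = ofField q hq ((w * v - q) / (w + v + 1)) := by
  change mulCoe q w v = _
  simp [mulCoe, h, ofField]

protected theorem one_mul' (v : NormTorus q hq) : 1 * v = v := rfl

theorem inv_ofField (w : K) : (ofField q hq w)⁻¹ = ofField q hq (-1 - w) := rfl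

@[elab_as_elim]
protected theorem ind {P : NormTorus q hq → Prop} (one : P 1) (of : ∀ w, P (ofField q hq w))
    (z : NormTorus q hq) : P z :=
  OnePoint.rec (X := K) (C := P) one of z

protected theorem mul_comm' (w v : NormTorus q hq) : w * v = v * w := by
  induction w using NormTorus.ind with
  | one => induction v using NormTorus.ind <;> rfl
  | of w =>
    induction v using NormTorus.ind with
    | one => rfl
    | of v =>
      by_cases h : w + v + 1 = 0
      · rw [ofField_mul_of_eq h, ofField_mul_of_eq (by linear_combination h)]
      · have h' : v + w + 1 ≠ 0 := by rwa [add_comm v]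
        rw [ofField_mul_of_ne h, ofField_mul_of_ne h', mul_comm w, add_comm w]

/-- The nonvanishing `v * v + v + q` is the norm of `v + M`; this is where `L` being a field enters.
-/
theorem mul_assoc_of_eq {w v : K} (h : w + v + 1 = 0) (u : K) :
    ofField q hq w * (ofField q hq v * ofField q hq u) = ofField q hq u := by
  obtain rfl : w = -1 - v := by linear_combination h
  by_cases h' : v + u + 1 = 0
  · rw [ofField_mul_of_eq h', NormTorus.mul_comm', NormTorus.one_mul']
    congr 1
    linear_combination -h'
  · have key : (-1 - v) + (v * u - q) / (v + u + 1) + 1 = -(v * v + v + q) / (v + u + 1) := by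
      field_simp
      ring
    have hv := hq v
    have h2 : (-1 - v) + (v * u - q) / (v + u + 1) + 1 ≠ 0 := by
      rw [key]
      exact div_ne_zero (neg_ne_zero.2 hv) h'
    rw [ofField_mul_of_ne h', ofField_mul_of_ne h2, key]
    congr 1
    rw [div_eq_iff (div_ne_zero (neg_ne_zero.2 hv) h')]
    field_simp
    ring

protected theorem mul_assoc' (w v u : NormTorus q hq) : w * v * u = w * (v * u) := by
  induction w using NormTorus.ind with
  | one => rfl
  | of w =>
  induction v using NormTorus.ind with
  | one => rfl
  | of v =>
  induction u using NormTorus.ind with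
  | one =>
    rw [NormTorus.mul_comm' _ 1, NormTorus.mul_comm' _ 1, NormTorus.one_mul', NormTorus.one_mul']
  | of u =>
  by_cases h : w + v + 1 = 0
  · rw [ofField_mul_of_eq h, NormTorus.one_mul', mul_assoc_of_eq h]
  · by_cases h' : v + u + 1 = 0
    · have h'' : u + v + 1 = 0 := by linear_combination h'
      rw [ofField_mul_of_eq h', NormTorus.mul_comm' _ 1, NormTorus.one_mul',
        NormTorus.mul_comm' _ (ofField q hq u), NormTorus.mul_comm' (ofField q hq w),
        mul_assoc_of_eq h'']
    · rw [ofField_mul_of_ne h, ofField_mul_of_ne h']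
      have e1 : (w * v - q) / (w + v + 1) + u + 1
          = (w * v - q + (u + 1) * (w + v + 1)) / (w + v + 1) := by field_simp; ring
      have e2 : w + (v * u - q) / (v + u + 1) + 1
          = (w * v - q + (u + 1) * (w + v + 1)) / (v + u + 1) := by field_simp; ring
      by_cases h3 : w * v - q + (u + 1) * (w + v + 1) = 0
      · rw [ofField_mul_of_eq (by rw [e1, h3, zero_div]),
          ofField_mul_of_eq (by rw [e2, h3, zero_div])]
      · rw [ofField_mul_of_ne (by rw [e1]; exact div_ne_zero h3 h),
          ofField_mul_of_ne (by rw [e2]; exact div_ne_zero h3 h'), e1, e2]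
        congr 1
        field_simp
        ring

noncomputable instance : CommGroup (NormTorus q hq) where
  mul_assoc := NormTorus.mul_assoc'
  one_mul := NormTorus.one_mul'
  mul_one w := by rw [NormTorus.mul_comm', NormTorus.one_mul']
  mul_comm := NormTorus.mul_comm'
  inv_mul_cancel w := by
    induction w using NormTorus.ind with
    | one => rfl
    | of w => rw [inv_ofField, ofField_mul_of_eq (by ring)]

variable (q hq) in
/-- The class of `1 + u M`. -/
noncomputable def chart (u : K) : NormTorus q hq := projInv (u : OnePoint K)

@[simp] theorem chart_zero : chart q hq 0 = 1 := projInv_zero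

theorem chart_of_ne {u : K} (hu : u ≠ 0) : chart q hq u = ofField q hq u⁻¹ := projInv_coe hu

theorem chart_mul_chart {u v : K} (h : 1 - q * u * v ≠ 0) :
    chart q hq u * chart q hq v = chart q hq ((u + v + u * v) / (1 - q * u * v)) := by
  rcases eq_or_ne u 0 with rfl | hu
  · simp
  rcases eq_or_ne v 0 with rfl | hv
  · simp
  have e : u⁻¹ + v⁻¹ + 1 = (u + v + u * v) / (u * v) := by field_simp; ring
  rw [chart_of_ne hu, chart_of_ne hv]
  by_cases h' : u + v + u * v = 0
  · rw [ofField_mul_of_eq (by rw [e, h', zero_div]), h', zero_div, chart_zero]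
  · rw [ofField_mul_of_ne (by rw [e]; exact div_ne_zero h' (mul_ne_zero hu hv)),
      chart_of_ne (div_ne_zero h' h), e]
    congr 1
    field_simp

end Algebra

section Topology

variable {K : Type*} [NontriviallyNormedField K] {q : K} {hq : ∀ x : K, x * x + x + q ≠ 0}

instance : TopologicalSpace (NormTorus q hq) := inferInstanceAs (TopologicalSpace (OnePoint K))

instance : CompactSpace (NormTorus q hq) := inferInstanceAs (CompactSpace (OnePoint K))

theorem continuous_inv' : Continuous (fun w : NormTorus q hq => w⁻¹) := by
  have h : (fun w : NormTorus q hq => w⁻¹) =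
      (projAffine (-1 : K) (-1) (neg_ne_zero.2 one_ne_zero) : OnePoint K → OnePoint K) := by
    funext w
    induction w using NormTorus.ind with
    | one => rfl
    | of w =>
      rw [inv_ofField]
      change _ = projAffine (-1 : K) (-1) _ (w : OnePoint K)
      rw [projAffine_coe]
      change ((_ : K) : OnePoint K) = _
      congr 1
      ring
  rw [h]
  exact (projAffine _ _ _).continuous


/-- Factoring a translation through affine maps and the inversion makes its continuity on the
projective line immediate. -/
theorem mul_ofField_eq (w : K) (v : NormTorus q hq) :
    ofField q hq w * v = projAffine (-(w * w + w + q)) w (neg_ne_zero.2 (hq w))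
      (projInv (projAffine 1 (w + 1) one_ne_zero (v : OnePoint K))) := by
  induction v using NormTorus.ind with
  | one =>
    change ofField q hq w = projAffine _ _ _ (projInv (projAffine _ _ _ ∞))
    simp only [projAffine_infty, projInv_infty, projAffine_coe, mul_zero, zero_add]
    rfl
  | of v =>
    change _ = projAffine _ _ _ (projInv (projAffine _ _ _ (v : OnePoint K)))
    rw [projAffine_coe, one_mul]
    by_cases h : w + v + 1 = 0
    · rw [ofField_mul_of_eq h, show v + (w + 1) = 0 by linear_combination h, projInv_zero]
      rfl
    · have h' : v + (w + 1) ≠ 0 := fun h' => h (by linear_combination h')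
      rw [ofField_mul_of_ne h, projInv_coe h', projAffine_coe]
      change ofField q hq _ = ofField q hq _
      congr 1
      field_simp
      ring

variable [ProperSpace K]

theorem isOpenEmbedding_chart : IsOpenEmbedding (chart q hq) :=
  (projInvHomeomorph (K := K)).isOpenEmbedding.comp OnePoint.isOpenEmbedding_coe

theorem map_chart_nhds_zero : map (chart q hq) (𝓝 0) = 𝓝 1 := by
  rw [isOpenEmbedding_chart.map_nhds_eq, chart_zero]

theorem continuous_mul_left' (w : NormTorus q hq) : Continuous (w * ·) := by
  induction w using NormTorus.ind with
  | one => simpa using continuous_id'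
  | of w =>
    simp only [mul_ofField_eq]
    exact (projAffine _ _ _).continuous.comp
      (continuous_projInv.comp (projAffine _ _ _).continuous)

/-- Left translation by `w`. -/
noncomputable def mulLeftHomeomorph (w : NormTorus q hq) : NormTorus q hq ≃ₜ NormTorus q hq where
  toFun := (w * ·)
  invFun := (w⁻¹ * ·)
  left_inv v := by simp
  right_inv v := by simp
  continuous_toFun := continuous_mul_left' w
  continuous_invFun := continuous_mul_left' w⁻¹

instance : IsTopologicalGroup (NormTorus q hq) := by
  refine IsTopologicalGroup.of_comm_of_nhds_one ?_ ?_ ?_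
  · rw [← map_chart_nhds_zero, prod_map_map_eq, tendsto_map'_iff, ← nhds_prod_eq]
    have h1 : ∀ᶠ z : K × K in 𝓝 (0, 0), 1 - q * z.1 * z.2 ≠ 0 :=
      ContinuousAt.eventually_ne (by fun_prop) (by simp)
    have h2 : ContinuousAt
        (fun z : K × K => (z.1 + z.2 + z.1 * z.2) / (1 - q * z.1 * z.2)) (0, 0) :=
      ContinuousAt.div (by fun_prop) (by fun_prop) (by simp)
    have h3 : Tendsto (fun z : K × K => (z.1 + z.2 + z.1 * z.2) / (1 - q * z.1 * z.2))
        (𝓝 (0, 0)) (𝓝 0) := by simpa [ContinuousAt] using h2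
    refine ((tendsto_map (f := chart q hq)).comp h3).congr' ?_
    filter_upwards [h1] with z hz
    exact (chart_mul_chart hz).symm
  · exact (continuous_inv' (q := q) (hq := hq)).tendsto' 1 1 inv_one
  · intro x
    have := (mulLeftHomeomorph x).map_nhds_eq 1
    rw [show mulLeftHomeomorph x 1 = x from mul_one x] at this
    exact this.symm

end Topology

end NormTorus

end NormTorus

/-! ### Closed subgroups near the identity over the `p`-adic numbers. -/

namespace NormTorus

section Padic

variable {p : ℕ} [Fact p.Prime] {q : ℚ_[p]} {hq : ∀ x : ℚ_[p], x * x + x + q ≠ 0} {r : ℝ}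

/-- The denominator `1 - q u v` has norm one, and what remains beyond `u + v` has the factor `u v`.
-/
theorem exists_chart_mul_chart (hr : r ≤ (p : ℝ)⁻¹ ^ 2) (hqr : ‖q‖ * r ≤ 1) {u v : ℚ_[p]}
    (hu : ‖u‖ ≤ r) (hv : ‖v‖ ≤ r) :
    ∃ w, chart q hq u * chart q hq v = chart q hq w ∧ ‖w - (u + v)‖ ≤ ‖u‖ * ‖v‖ := by
  have hp : (p : ℝ)⁻¹ < 1 := inv_lt_one_of_one_lt₀ (mod_cast (Fact.out : p.Prime).one_lt)
  have hp0 : 0 < (p : ℝ)⁻¹ := inv_pos.2 (mod_cast (Fact.out : p.Prime).pos)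
  have hr0 : 0 ≤ r := (norm_nonneg u).trans hu
  have hr1 : r < 1 := hr.trans_lt (pow_lt_one₀ hp0.le hp two_ne_zero)
  have hquv : ‖q * u * v‖ < 1 := by
    rw [norm_mul, norm_mul]
    calc ‖q‖ * ‖u‖ * ‖v‖ ≤ ‖q‖ * r * r := by gcongr
      _ ≤ 1 * r := by gcongr
      _ < 1 := by linarith
  have hden : ‖1 - q * u * v‖ = 1 := by
    rw [sub_eq_add_neg, Padic.add_eq_max_of_ne, norm_neg, norm_one, max_eq_left hquv.le]
    rw [norm_neg, norm_one]
    exact hquv.ne'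
  have hden0 : 1 - q * u * v ≠ 0 := fun h => by simp [h] at hden
  refine ⟨_, chart_mul_chart hden0, ?_⟩
  have e : (u + v + u * v) / (1 - q * u * v) - (u + v)
      = u * v * (1 + q * (u + v)) / (1 - q * u * v) := by
    rw [eq_div_iff hden0, sub_mul, div_mul_cancel₀ _ hden0]
    ring
  have h1 : ‖1 + q * (u + v)‖ ≤ 1 := by
    refine (Padic.nonarchimedean _ _).trans (max_le norm_one.le ?_)
    rw [norm_mul]
    refine le_trans ?_ hqr
    gcongr
    exact (Padic.nonarchimedean _ _).trans (max_le hu hv)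
  rw [e, norm_div, hden, div_one, norm_mul, norm_mul]
  exact mul_le_of_le_one_right (by positivity) h1

/-- The quadratic errors do not accumulate with `n`, by the ultrametric inequality. -/
theorem exists_chart_pow (hr : r ≤ (p : ℝ)⁻¹ ^ 2) (hqr : ‖q‖ * r ≤ 1) {u : ℚ_[p]}
    (hu : ‖u‖ ≤ r) (n : ℕ) :
    ∃ w, chart q hq u ^ n = chart q hq w ∧ ‖w‖ ≤ ‖u‖ ∧ ‖w - n * u‖ ≤ ‖u‖ ^ 2 := by
  have hp : (p : ℝ)⁻¹ < 1 := inv_lt_one_of_one_lt₀ (mod_cast (Fact.out : p.Prime).one_lt)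
  have hp0 : 0 < (p : ℝ)⁻¹ := inv_pos.2 (mod_cast (Fact.out : p.Prime).pos)
  have hu1 : ‖u‖ ≤ 1 := (hu.trans hr).trans (pow_le_one₀ hp0.le hp.le)
  induction n with
  | zero => exact ⟨0, by simp, by simp, by simp⟩
  | succ n ih =>
    obtain ⟨w, hw, hwu, hwn⟩ := ih
    obtain ⟨w', hw', hw'u⟩ := exists_chart_mul_chart (hq := hq) hr hqr (hwu.trans hu) hu
    have h : ‖w' - (n + 1 : ℕ) * u‖ ≤ ‖u‖ ^ 2 := by
      have e : w' - (n + 1 : ℕ) * u = (w' - (w + u)) + (w - n * u) := by push_cast; ring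
      rw [e]
      refine (Padic.nonarchimedean _ _).trans (max_le (hw'u.trans ?_) hwn)
      rw [sq]
      gcongr
    refine ⟨w', by rw [pow_succ, hw, hw'], ?_, h⟩
    rw [← sub_add_cancel w' ((n + 1 : ℕ) * u)]
    refine (Padic.nonarchimedean _ _).trans (max_le (h.trans ?_) ?_)
    · exact pow_le_of_le_one (norm_nonneg _) hu1 two_ne_zero
    · rw [norm_mul]
      exact mul_le_of_le_one_left (norm_nonneg _) (mod_cast Padic.norm_int_le_one _)

/-- Taking a `p`-th power divides the norm by exactly `p`: since `‖y‖ < 1 / p`, the quadratic error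
is smaller than `‖p y‖`. -/
theorem exists_chart_mem_norm_eq (hr : r ≤ (p : ℝ)⁻¹ ^ 2) (hqr : ‖q‖ * r ≤ 1)
    {H : Subgroup (NormTorus q hq)} {x : ℚ_[p]} (hx : ‖x‖ ≤ r) (hx0 : x ≠ 0)
    (hxH : chart q hq x ∈ H) (j : ℕ) :
    ∃ x', chart q hq x' ∈ H ∧ ‖x'‖ = ‖x‖ * (p : ℝ)⁻¹ ^ j := by
  have hp : (p : ℝ)⁻¹ < 1 := inv_lt_one_of_one_lt₀ (mod_cast (Fact.out : p.Prime).one_lt)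
  have hp0 : 0 < (p : ℝ)⁻¹ := inv_pos.2 (mod_cast (Fact.out : p.Prime).pos)
  induction j with
  | zero => exact ⟨x, hxH, by simp⟩
  | succ j ih =>
    obtain ⟨y, hyH, hy⟩ := ih
    have hyr : ‖y‖ ≤ r := by
      rw [hy]
      exact (mul_le_of_le_one_right (norm_nonneg _) (pow_le_one₀ hp0.le hp.le)).trans hx
    have hy0 : 0 < ‖y‖ := by
      rw [hy]
      exact mul_pos (norm_pos_iff.2 hx0) (pow_pos hp0 j)
    obtain ⟨w, hw, -, hwp⟩ := exists_chart_pow (hq := hq) hr hqr hyr p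
    have hpy : ‖(p : ℚ_[p]) * y‖ = (p : ℝ)⁻¹ * ‖y‖ := by rw [norm_mul, Padic.norm_p]
    have hlt : ‖w - p * y‖ < ‖(p : ℚ_[p]) * y‖ := by
      rw [hpy]
      refine hwp.trans_lt ?_
      rw [sq]
      have : ‖y‖ < (p : ℝ)⁻¹ := (hyr.trans hr).trans_lt (by nlinarith)
      gcongr
    refine ⟨w, hw ▸ H.pow_mem hyH p, ?_⟩
    rw [← sub_add_cancel w (p * y), Padic.add_eq_max_of_ne hlt.ne, max_eq_right hlt.le, hpy,
      hy, pow_succ]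
    ring

theorem exists_natCast_norm_add_mul_le {x y : ℚ_[p]} (hx : x ≠ 0) (hyx : ‖y‖ ≤ ‖x‖) :
    ∃ m : ℕ, ‖y + m * x‖ ≤ (p : ℝ)⁻¹ * ‖x‖ := by
  have hp0 : 0 < (p : ℝ)⁻¹ := inv_pos.2 (mod_cast (Fact.out : p.Prime).pos)
  have hx' : 0 < ‖x‖ := norm_pos_iff.2 hx
  let z : ℤ_[p] := ⟨-(y / x), by rw [norm_neg, norm_div]; exact (div_le_one hx').2 hyx⟩
  obtain ⟨m, hm⟩ := PadicInt.denseRange_natCast.exists_dist_lt z hp0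
  refine ⟨m, ?_⟩
  have e : y + m * x = -((-(y / x) - m) * x) := by field_simp; ring
  rw [e, norm_neg, norm_mul]
  gcongr
  rw [dist_eq_norm, PadicInt.norm_def] at hm
  exact_mod_cast hm.le

/-- Successive approximation: `H` has an element of each norm `‖x‖ p⁻ʲ`, and a suitable natural
power of it cancels the leading digit of `y'`, by density of `ℕ` in `ℤ_[p]`. -/
theorem exists_chart_mul_eq_chart (hr : r ≤ (p : ℝ)⁻¹ ^ 2) (hqr : ‖q‖ * r ≤ 1)
    {H : Subgroup (NormTorus q hq)} {x y : ℚ_[p]} (hx : ‖x‖ ≤ r) (hx0 : x ≠ 0)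
    (hxH : chart q hq x ∈ H) (hyx : ‖y‖ ≤ ‖x‖) (j : ℕ) :
    ∃ h ∈ H, ∃ y', chart q hq y * h = chart q hq y' ∧ ‖y'‖ ≤ ‖x‖ * (p : ℝ)⁻¹ ^ j := by
  have hp : (p : ℝ)⁻¹ < 1 := inv_lt_one_of_one_lt₀ (mod_cast (Fact.out : p.Prime).one_lt)
  have hp0 : 0 < (p : ℝ)⁻¹ := inv_pos.2 (mod_cast (Fact.out : p.Prime).pos)
  induction j with
  | zero => exact ⟨1, H.one_mem, y, by simp, by simpa using hyx⟩
  | succ j ih =>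
    obtain ⟨h, hh, y', hy', hy'n⟩ := ih
    obtain ⟨x', hx'H, hx'⟩ := exists_chart_mem_norm_eq hr hqr hx hx0 hxH j
    rw [← hx'] at hy'n
    have hx'0 : x' ≠ 0 := by
      rw [← norm_pos_iff, hx']
      exact mul_pos (norm_pos_iff.2 hx0) (pow_pos hp0 j)
    have hx'r : ‖x'‖ ≤ r := by
      rw [hx']
      exact (mul_le_of_le_one_right (norm_nonneg _) (pow_le_one₀ hp0.le hp.le)).trans hx
    obtain ⟨m, hm⟩ := exists_natCast_norm_add_mul_le hx'0 hy'n
    obtain ⟨w, hw, hwn, hwm⟩ := exists_chart_pow (hq := hq) hr hqr hx'r m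
    obtain ⟨y'', hy'', hn⟩ :=
      exists_chart_mul_chart (hq := hq) hr hqr (hy'n.trans hx'r) (hwn.trans hx'r)
    have hsq : ‖x'‖ ^ 2 ≤ (p : ℝ)⁻¹ * ‖x'‖ := by
      have : ‖x'‖ ≤ (p : ℝ)⁻¹ := (hx'r.trans hr).trans (by nlinarith)
      rw [sq]
      gcongr
    refine ⟨h * chart q hq x' ^ m, H.mul_mem hh (H.pow_mem hx'H m), y'', ?_, ?_⟩
    · rw [← mul_assoc, hy', hw, hy'']
    · have e : y'' = (y'' - (y' + w)) + ((w - m * x') + (y' + m * x')) := by ring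
      have e' : ‖x‖ * (p : ℝ)⁻¹ ^ (j + 1) = (p : ℝ)⁻¹ * ‖x'‖ := by rw [hx', pow_succ]; ring
      rw [e, e']
      refine (Padic.nonarchimedean _ _).trans (max_le (hn.trans (le_trans ?_ hsq)) ?_)
      · rw [sq]
        gcongr
      · exact (Padic.nonarchimedean _ _).trans (max_le (hwm.trans hsq) hm)

theorem chart_mem_of_norm_le (hr : r ≤ (p : ℝ)⁻¹ ^ 2) (hqr : ‖q‖ * r ≤ 1)
    {H : Subgroup (NormTorus q hq)} (hH : IsClosed (H : Set (NormTorus q hq))) {x y : ℚ_[p]}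
    (hx : ‖x‖ ≤ r) (hx0 : x ≠ 0) (hxH : chart q hq x ∈ H) (hyx : ‖y‖ ≤ ‖x‖) :
    chart q hq y ∈ H := by
  have hp : (p : ℝ)⁻¹ < 1 := inv_lt_one_of_one_lt₀ (mod_cast (Fact.out : p.Prime).one_lt)
  have hp0 : 0 < (p : ℝ)⁻¹ := inv_pos.2 (mod_cast (Fact.out : p.Prime).pos)
  choose h hh y' hy' hn using exists_chart_mul_eq_chart (hq := hq) hr hqr hx hx0 hxH hyx
  have hlim : Tendsto (fun j => ‖x‖ * (p : ℝ)⁻¹ ^ j) atTop (𝓝 0) := by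
    simpa using (tendsto_pow_atTop_nhds_zero_of_lt_one hp0.le hp).const_mul ‖x‖
  have h1 : Tendsto y' atTop (𝓝 0) := squeeze_zero_norm hn hlim
  have h2 : Tendsto (fun j => chart q hq (y' j)) atTop (𝓝 1) := by
    rw [← map_chart_nhds_zero]
    exact tendsto_map.comp h1
  have h3 : Tendsto h atTop (𝓝 (chart q hq y)⁻¹) := by
    have := h2.const_mul (chart q hq y)⁻¹
    rw [mul_one] at this
    refine this.congr fun j => ?_
    rw [← hy' j, inv_mul_cancel_left]
  exact inv_mem_iff.1 (hH.mem_of_tendsto h3 (Eventually.of_forall hh))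

theorem isOpen_topologicalClosure_zpowers {g : NormTorus q hq} (hg : ∀ n : ℕ, 0 < n → g ^ n ≠ 1) :
    IsOpen ((Subgroup.zpowers g).topologicalClosure : Set (NormTorus q hq)) := by
  have hp0 : 0 < (p : ℝ)⁻¹ := inv_pos.2 (mod_cast (Fact.out : p.Prime).pos)
  set H := (Subgroup.zpowers g).topologicalClosure with hH
  obtain ⟨r, hr0, hr, hqr⟩ : ∃ r : ℝ, 0 < r ∧ r ≤ (p : ℝ)⁻¹ ^ 2 ∧ ‖q‖ * r ≤ 1 := by
    -- The first bound makes squares negligible against multiplication by `p`; the second controls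
    -- the terms involving `q`.
    refine ⟨min ((p : ℝ)⁻¹ ^ 2) (‖q‖ + 1)⁻¹, by positivity, min_le_left _ _, ?_⟩
    calc ‖q‖ * min ((p : ℝ)⁻¹ ^ 2) (‖q‖ + 1)⁻¹ ≤ (‖q‖ + 1) * (‖q‖ + 1)⁻¹ := by
          gcongr
          · linarith
          · exact min_le_right _ _
      _ = 1 := mul_inv_cancel₀ (by positivity)
  have hU : chart q hq '' Metric.closedBall 0 r ∈ 𝓝 (1 : NormTorus q hq) := by
    rw [← map_chart_nhds_zero]
    exact image_mem_map (Metric.closedBall_mem_nhds _ hr0)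
  obtain ⟨n, hn, x, hx, hxg⟩ := exists_pos_pow_mem_of_mem_nhds_one g hU
  rw [mem_closedBall_zero_iff] at hx
  have hx0 : x ≠ 0 := by
    rintro rfl
    exact hg n hn (by rw [← hxg, chart_zero])
  have hxH : chart q hq x ∈ H := by
    rw [hxg]
    exact Subgroup.le_topologicalClosure _ (Subgroup.npow_mem_zpowers g n)
  refine H.isOpen_of_mem_nhds (g := 1) ?_
  rw [← map_chart_nhds_zero]
  refine mem_map.2 (mem_of_superset (Metric.closedBall_mem_nhds _ (norm_pos_iff.2 hx0)) ?_)
  intro y hy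
  rw [mem_closedBall_zero_iff] at hy
  exact chart_mem_of_norm_le hr hqr (Subgroup.isClosed_topologicalClosure _) hx hx0 hxH hy

end Padic

end NormTorus

/-! ### Normal form of a homography. -/

section Homographic

variable {K : Type*} [Field K] {a b c d : K}

theorem homographic_infty (hc : c ≠ 0) :
    homographic a b c d ∞ = ((a / c : K) : OnePoint K) := by
  simp [homographic, hc]

theorem homographic_coe_of_eq {x : K} (h : c * x + d = 0) : homographic a b c d x = ∞ := by
  simp [homographic, h]

theorem homographic_coe_of_ne {x : K} (h : c * x + d ≠ 0) :
    homographic a b c d x = (((a * x + b) / (c * x + d) : K) : OnePoint K) := by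
  simp [homographic, h]

theorem ne_zero_of_homographic_ne_self (h : ∀ z : OnePoint K, homographic a b c d z ≠ z) :
    c ≠ 0 := by
  rintro rfl
  exact h ∞ (by simp [homographic])

/-- By Cayley–Hamilton, a matrix of trace zero has scalar square. -/
theorem homographic_iterate_two_of_trace_eq_zero (hdet : a * d - b * c ≠ 0) (hc : c ≠ 0)
    (ht : a + d = 0) : (homographic a b c d)^[2] = id := by
  obtain rfl : d = -a := by linear_combination ht
  funext z
  simp only [iterate_succ, iterate_zero, comp_apply, id]
  induction z using OnePoint.rec with
  | infty =>
    rw [homographic_infty hc, homographic_coe_of_eq]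
    field_simp
    ring
  | coe x =>
    by_cases h : c * x + -a = 0
    · rw [homographic_coe_of_eq h, homographic_infty hc]
      congr 1
      rw [div_eq_iff hc]
      linear_combination -h
    · have e : c * ((a * x + b) / (c * x + -a)) + -a = -(a * -a - b * c) / (c * x + -a) := by
        rw [eq_div_iff h, add_mul, mul_assoc, div_mul_cancel₀ _ h]
        ring
      have e0 : -(a * -a - b * c) / (c * x + -a) ≠ 0 := div_ne_zero (neg_ne_zero.2 hdet) h
      rw [homographic_coe_of_ne h, homographic_coe_of_ne (by rwa [e]), e]
      congr 1
      rw [div_eq_iff e0, mul_div_assoc', mul_div_assoc', div_add' _ _ _ h, div_left_inj' h]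
      ring

variable [TopologicalSpace K] [IsTopologicalRing K]

/-- The affine map is the one sending `φ(∞) = a / c` to `0` and the pole `-d / c` to `-1`. -/
theorem semiconj_projAffine_homographic (hc : c ≠ 0) (ht : a + d ≠ 0) :
    Semiconj (projAffine (c / (a + d)) (-a / (a + d)) (div_ne_zero hc ht))
      (homographic a b c d)
      (homographic 0 (-((a * d - b * c) / (a + d) ^ 2)) 1 1) := by
  intro z
  induction z using OnePoint.rec with
  | infty =>
    rw [homographic_infty hc, projAffine_infty, homographic_infty one_ne_zero, projAffine_coe]
    congr 1
    field_simp
    ring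
  | coe x =>
    have e : (1 : K) * (c / (a + d) * x + -a / (a + d)) + 1 = (c * x + d) / (a + d) := by
      field_simp
      ring
    rw [projAffine_coe]
    by_cases h : c * x + d = 0
    · rw [homographic_coe_of_eq h, projAffine_infty, homographic_coe_of_eq]
      rw [e, h, zero_div]
    · rw [homographic_coe_of_ne h, projAffine_coe, homographic_coe_of_ne, e]
      · congr 1
        field_simp
        ring
      · rw [e]
        exact div_ne_zero h ht

end Homographic

/-! ### Conjugacy with a group translation, and the main theorem. -/

namespace NormTorus

section Conjugacy

variable {K : Type*} [NontriviallyNormedField K] {q : K} {hq : ∀ x : K, x * x + x + q ≠ 0}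

variable (q hq) in
/-- The identification of the group with the projective line. -/
def toProj : NormTorus q hq ≃ₜ OnePoint K := Homeomorph.refl (OnePoint K)

/-- `M (v + M) = -q + (v + 1) M`. -/
theorem semiconj_toProj :
    Semiconj (toProj q hq) (ofField q hq 0 * ·) (homographic 0 (-q) 1 1) := by
  intro z
  induction z using NormTorus.ind with
  | one =>
    change ((0 : K) : OnePoint K) = homographic 0 (-q) 1 1 ∞
    rw [homographic_infty one_ne_zero, zero_div]
  | of v =>
    change toProj q hq (ofField q hq 0 * ofField q hq v) =
      homographic 0 (-q) 1 1 (v : OnePoint K)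
    by_cases h : (0 : K) + v + 1 = 0
    · rw [ofField_mul_of_eq h, homographic_coe_of_eq (by linear_combination h)]
      rfl
    · rw [ofField_mul_of_ne h, homographic_coe_of_ne (by simpa using h)]
      change ((_ : K) : OnePoint K) = _
      congr 1
      ring

end Conjugacy

end NormTorus

theorem mul_self_add_self_add_ne_zero_of_homographic_ne_self {K : Type*} [Field K] {q : K}
    (hq : q ≠ 0) (h : ∀ z : OnePoint K, homographic 0 (-q) 1 1 z ≠ z) (x : K) :
    x * x + x + q ≠ 0 := by
  intro hx
  have h1 : 1 * x + 1 ≠ 0 := fun h1 => hq (by linear_combination hx - x * h1)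
  refine h x ?_
  rw [homographic_coe_of_ne h1]
  congr 1
  rw [div_eq_iff h1]
  linear_combination -hx

theorem trace_ne_zero_of_homographic_iterate_ne_id {K : Type*} [Field K] {a b c d : K}
    (hdet : a * d - b * c ≠ 0) (hfix : ∀ z : OnePoint K, homographic a b c d z ≠ z)
    (hord : ∀ n : ℕ, 0 < n → (homographic a b c d)^[n] ≠ id) : a + d ≠ 0 := fun ht =>
  hord 2 two_pos (homographic_iterate_two_of_trace_eq_zero hdet
    (ne_zero_of_homographic_ne_self hfix) ht)

/-- A homography without fixed points and of infinite order is conjugate to a translation of a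
group `NormTorus q`, where `q` is the determinant divided by the square of the trace. -/
theorem exists_semiconj_normTorus {K : Type*} [NontriviallyNormedField K] {a b c d : K}
    (hdet : a * d - b * c ≠ 0) (hfix : ∀ z : OnePoint K, homographic a b c d z ≠ z)
    (hord : ∀ n : ℕ, 0 < n → (homographic a b c d)^[n] ≠ id) :
    ∃ (hq : ∀ x : K, x * x + x + (a * d - b * c) / (a + d) ^ 2 ≠ 0)
      (h : NormTorus _ hq ≃ₜ OnePoint K),
      Semiconj h (NormTorus.ofField _ hq 0 * ·) (homographic a b c d) := by
  have hc := ne_zero_of_homographic_ne_self hfix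
  have ht := trace_ne_zero_of_homographic_iterate_ne_id hdet hfix hord
  have hs := semiconj_projAffine_homographic (b := b) hc ht
  refine ⟨mul_self_add_self_add_ne_zero_of_homographic_ne_self
    (div_ne_zero hdet (pow_ne_zero 2 ht)) fun z hz => ?_,
    (NormTorus.toProj _ _).trans
      (projAffine (c / (a + d)) (-a / (a + d)) (div_ne_zero hc ht)).symm, ?_⟩
  · refine hfix ((projAffine (c / (a + d)) (-a / (a + d)) (div_ne_zero hc ht)).symm z) ?_
    rw [← hs.homeomorph_symm, hz]
  · exact hs.homeomorph_symm.comp_left NormTorus.semiconj_toProj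

/-- A ratio `λ = α / β` of eigenvalues satisfies `λ / (1 + λ) ^ 2 = α β / (α + β) ^ 2`, which is
symmetric, so the choice of square root is immaterial. -/
theorem div_one_add_sq_eq {L : Type*} [Field L] [CharZero L] {t D s : L} (ht : t ≠ 0)
    (hD : D ≠ 0) (hs : s ^ 2 = t ^ 2 - 4 * D) :
    (t + s) / (t - s) / (1 + (t + s) / (t - s)) ^ 2 = D / t ^ 2 := by
  have hts : t - s ≠ 0 := by
    intro h
    have : 4 * D = 0 := by linear_combination hs + (t + s) * h
    exact hD (by simpa using this)
  have e : 1 + (t + s) / (t - s) = 2 * t / (t - s) := by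
    field_simp
    ring
  rw [e, div_pow, div_div_eq_mul_div, div_mul_eq_mul_div, div_div, div_eq_div_iff
    (mul_ne_zero hts (pow_ne_zero 2 (mul_ne_zero two_ne_zero ht))) (pow_ne_zero 2 ht)]
  linear_combination (-(t ^ 2 * (t - s))) * hs

theorem theorem1 (p : ℕ) [Fact p.Prime] :
    ∃ N : AlgebraicClosure ℚ_[p] → ℕ,
      ∀ a b c d : ℚ_[p], a * d - b * c ≠ 0 →
        (∀ z : OnePoint ℚ_[p], homographic a b c d z ≠ z) →
        (∀ n : ℕ, 0 < n → (homographic a b c d)^[n] ≠ id) →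
        {E | IsMinimalSubsystem (homographic a b c d) E}.Finite ∧
        {E | IsMinimalSubsystem (homographic a b c d) E}.PairwiseDisjoint id ∧
        ⋃₀ {E | IsMinimalSubsystem (homographic a b c d) E} = Set.univ ∧
        (∀ E F : Set (OnePoint ℚ_[p]),
          IsMinimalSubsystem (homographic a b c d) E →
          IsMinimalSubsystem (homographic a b c d) F →
          SubsystemsConjugate (homographic a b c d) E F) ∧
        ∀ s : AlgebraicClosure ℚ_[p],
          s ^ 2 = algebraMap ℚ_[p] (AlgebraicClosure ℚ_[p]) ((d - a) ^ 2 + 4 * b * c) →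
          {E | IsMinimalSubsystem (homographic a b c d) E}.ncard =
            N ((algebraMap ℚ_[p] (AlgebraicClosure ℚ_[p]) (a + d) + s) /
              (algebraMap ℚ_[p] (AlgebraicClosure ℚ_[p]) (a + d) - s)) := by
  -- `N` counts the minimal subsystems of the normal form with `q = l / (1 + l) ^ 2`. For the
  -- relevant `l` this lies in `ℚ_[p]`, so the default value of `invFun` never matters.
  refine ⟨fun l => {E | IsMinimalSubsystem (homographic (0 : ℚ_[p])
    (-(invFun (algebraMap ℚ_[p] (AlgebraicClosure ℚ_[p])) (l / (1 + l) ^ 2))) 1 1) E}.ncard, ?_⟩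
  intro a b c d hdet hfix hord
  have hc := ne_zero_of_homographic_ne_self hfix
  have ht := trace_ne_zero_of_homographic_iterate_ne_id hdet hfix hord
  obtain ⟨hq, h, hs⟩ := exists_semiconj_normTorus hdet hfix hord
  have hg : ∀ n : ℕ, 0 < n → NormTorus.ofField _ hq 0 ^ n ≠ 1 := by
    intro n hn hgn
    refine hord n hn (funext fun z => ?_)
    obtain ⟨w, rfl⟩ := h.surjective z
    rw [← (hs.iterate_right n) w, mul_left_iterate, hgn]
    exact congrArg h (one_mul w)
  -- An open subgroup of a compact group has finite index.
  have hfin := Subgroup.quotient_finite_of_isOpen _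
    (NormTorus.isOpen_topologicalClosure_zpowers hg)
  rw [setOf_isMinimalSubsystem_eq_image h hs]
  refine ⟨(finite_isMinimalSubsystem_mul_left _).image _, ?_, ?_, ?_, ?_⟩
  · rw [← setOf_isMinimalSubsystem_eq_image h hs]
    exact pairwiseDisjoint_isMinimalSubsystem _
  · rw [sUnion_image, ← image_iUnion₂, ← sUnion_eq_biUnion, sUnion_isMinimalSubsystem_mul_left,
      image_univ, h.range_coe]
  · intro E F hE hF
    have := (subsystemsConjugate_mul_left _ (hE.image h.symm hs.homeomorph_symm)
      (hF.image h.symm hs.homeomorph_symm)).image h hs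
    simpa [image_image] using this
  · intro s hsq
    have hmap : ∀ x : ℚ_[p], x ≠ 0 → algebraMap ℚ_[p] (AlgebraicClosure ℚ_[p]) x ≠ 0 :=
      fun x hx => (map_ne_zero _).2 hx
    have key := div_one_add_sq_eq (s := s) (hmap _ ht) (hmap _ hdet) (by
      rw [hsq, ← map_ofNat (algebraMap ℚ_[p] (AlgebraicClosure ℚ_[p])), ← map_pow, ← map_mul,
        ← map_sub]
      congr 1
      ring)
    rw [← map_pow, ← map_div₀] at key
    simp only [key]
    rw [leftInverse_invFun (algebraMap ℚ_[p] (AlgebraicClosure ℚ_[p])).injective,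
      ← setOf_isMinimalSubsystem_eq_image h hs]
    exact (ncard_isMinimalSubsystem_congr _ (semiconj_projAffine_homographic hc ht)).symm
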